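/- A *quantale* is here a complete lattice $A$ (with least element $0$ and greatest element $1$) carrying an associative commutative multiplication which distributes over arbitrary joins and for which $1$ is the unit. Let $K(A)$ be the set of compact elements of $A$. The quantale $A$ is *coherent* if every element is a join of compact elements, $1\in K(A)$, and $K(A)$ is closed under multiplication. For $a\in A$ put $a^{\perp}=\bigvee\{x\in A : ax=0\}$. An element $p\neq 1$ is *$m$-prime* if $ab\le p$ implies $a\le p$ or $b\le p$, for all $a,b\in A$; $\mathrm{Spec}(A)$ is the set of $m$-prime elements, $\mathrm{Min}(A)$ the set of minimal elements of $\mathrm{Spec}(A)$, and $V(a)=\{p\in \mathrm{Spec}(A): a\le p\}$. The quantale $A$ is *semiprime* if $\bigwedge \mathrm{Spec}(A)=0$. Let $B(A)$ be the set of complemented elements of the lattice $A$; for $e\in B(A)$ the complement is $\neg e=e^{\perp}$. The spectral topology on $\mathrm{Spec}(A)$ is the one whose closed sets are the sets $V(a)$, $a\in A$; the flat topology on $\mathrm{Spec}(A)$ has as a basis of open sets the complements of the compact open sets of the spectral topology. $\mathrm{Min}_F(A)$ is the set $\mathrm{Min}(A)$ with the topology induced by the flat topology. A *Boolean space* is a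 compact Hausdorff totally disconnected space. - $A$ is *purified* if for all distinct $p,q\in \mathrm{Min}(A)$ there is $e\in B(A)$ with $e\le p$ and $\neg e\le q$. - $A$ is an *$mp$-quantale* if for every $p\in \mathrm{Spec}(A)$ there is a unique $q\in \mathrm{Min}(A)$ with $q\le p$. - An element is *regular* if it is a join of complemented elements. The Pierce spectrum $\mathrm{Sp}(A)$ is the set of maximal elements of the set of regular elements $\ne 1$. - An element $a$ is *pure* if $a\vee c^{\perp}=1$ for every $c\in K(A)$ with $c\le a$. **Theorem 7.5.** For a semiprime coherent quantale $A$ the following are equivalent: 1. $A$ is purified; 2. $A$ is an $mp$-quantale and $\mathrm{Min}_F(A)$ is totally separated; 3. $A$ is an $mp$-quantale and $\mathrm{Min}_F(A)$ is totally disconnected; 4. $A$ is an $mp$-quantale and $\mathrm{Min}_F(A)$ is a Boolean space; 5. the family $(V(e)\cap \mathrm{Min}(A))_{e\in B(A)}$ is a basis of open sets for $\mathrm{Min}_F(A)$; 6. every minimal $m$-prime element of $A$ is regular; 7. $\mathrm{Min}(A)=\mathrm{Sp}(A)$; 8. $A$ is an $mp$-quantale and every pure element of $A$ is regular. -/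

import Mathlib

/-!
Commutative integral quantales are modelled as `[CommMonoid A] [CompleteLattice A] [IsQuantale A]`
together with `Quantale.IsIntegral A`, which says that the unit of the monoid is the top element.
-/

namespace Quantale

/-- A quantale is integral if its top element is a unit for the multiplication. -/
class IsIntegral (A : Type*) [CommMonoid A] [CompleteLattice A] : Prop where
  one_eq_top : (1 : A) = ⊤

variable {A : Type*} [CommMonoid A] [CompleteLattice A] [IsQuantale A]

variable (A) in
/-- A coherent quantale: every element is a join of compact elements, the top element is compact
and the compact elements are closed under multiplication. -/
structure IsCoherent : Prop where
  algebraic : ∀ a : A, ∃ X : Set A, (∀ c ∈ X, IsCompactElement c) ∧ sSup X = a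
  top_compact : IsCompactElement (⊤ : A)
  mul_compact : ∀ c d : A, IsCompactElement c → IsCompactElement d → IsCompactElement (c * d)

/-- The negation `a^⊥`, the join of all `x` with `a * x = 0`. -/
def neg (a : A) : A := sSup {x | a * x = ⊥}

/-- `m`-prime elements. -/
def IsMPrime (p : A) : Prop := p ≠ ⊤ ∧ ∀ a b : A, a * b ≤ p → a ≤ p ∨ b ≤ p

/-- The radical: the meet of all `m`-prime elements above `a`. -/
def radical (a : A) : A := sInf {p | IsMPrime p ∧ a ≤ p}

variable (A) in
/-- A quantale is semiprime if the radical of `0` is `0`. -/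
def IsSemiprime : Prop := radical (⊥ : A) = ⊥

variable (A) in
/-- The Boolean center `B(A)`: the complemented elements. -/
def booleanCenter : Set A := {e | IsComplemented e}

/-- Regular elements: the joins of complemented elements. -/
def IsRegularElement (a : A) : Prop := ∃ E : Set A, E ⊆ booleanCenter A ∧ a = sSup E

variable (A) in
/-- The Pierce spectrum `Sp(A)`: the maximal elements among the proper regular elements. -/
def pierceSpectrum : Set A := {a | Maximal (fun x : A => x ≠ ⊤ ∧ IsRegularElement x) a}

/-- Pure elements. -/
def IsPure (a : A) : Prop := ∀ c : A, IsCompactElement c → c ≤ a → a ⊔ neg c = ⊤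

variable (A) in
/-- `Spec(A)`. -/
def Spec : Set A := {p | IsMPrime p}

variable (A) in
/-- `Min(A)`: the minimal elements of `Spec(A)`. -/
def minSpec : Set A := {p | Minimal IsMPrime p}

variable (A) in
/-- `A` is an `mp`-quantale if every `m`-prime element lies above a unique minimal one. -/
def IsMp : Prop := ∀ p ∈ Spec A, ∃! q, q ∈ minSpec A ∧ q ≤ p

variable (A) in
/-- `A` is purified if any two distinct minimal `m`-prime elements are separated by a
complemented element. -/
def IsPurified : Prop :=
  ∀ p ∈ minSpec A, ∀ q ∈ minSpec A, p ≠ q → ∃ e ∈ booleanCenter A, e ≤ p ∧ neg e ≤ q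

/-- `V(a)`, as a set of `m`-prime elements. -/
def V (a : A) : Set (Spec A) := {p | a ≤ p.1}

theorem mul_le_inf [IsIntegral A] (a b : A) : a * b ≤ a ⊓ b := by
  refine le_inf ?_ ?_
  · calc a * b ≤ a * 1 := mul_le_mul_right (IsIntegral.one_eq_top (A := A) ▸ le_top) a
      _ = a := mul_one a
  · calc a * b ≤ 1 * b := mul_le_mul_left (IsIntegral.one_eq_top (A := A) ▸ le_top) b
      _ = b := one_mul b

variable (A) in
/-- The spectral (Zariski) topology on `Spec(A)`: the closed sets are exactly the `V(a)`. -/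
abbrev zariskiTopology [IsIntegral A] : TopologicalSpace (Spec A) :=
  TopologicalSpace.ofClosed (Set.range (V (A := A)))
    ⟨⊤, Set.eq_empty_iff_forall_notMem.2 fun p hp => p.2.1 (top_le_iff.1 hp)⟩
    (fun S hS => ⟨sSup {a | V a ∈ S}, by
      ext p
      simp only [V, Set.mem_sInter, Set.mem_ofPred_eq, sSup_le_iff]
      constructor
      · intro h t ht
        obtain ⟨a, rfl⟩ := hS ht
        exact h a ht
      · intro h a ha
        exact h _ ha⟩)
    (by
      rintro _ ⟨a, rfl⟩ _ ⟨b, rfl⟩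
      refine ⟨a * b, ?_⟩
      ext p
      constructor
      · intro h
        exact p.2.2 a b h
      · rintro (h | h)
        · exact ((mul_le_inf a b).trans inf_le_left).trans h
        · exact ((mul_le_inf a b).trans inf_le_right).trans h)

variable (A) in
/-- The flat topology on `Spec(A)`: it has the complements of the compact open
subsets of the spectral topology as a basis of open sets. -/
abbrev flatTopology [IsIntegral A] : TopologicalSpace (Spec A) :=
  TopologicalSpace.generateFrom
    {U | @IsCompact _ (zariskiTopology A) Uᶜ ∧ @IsOpen _ (zariskiTopology A) Uᶜ}

variable (A) in
/-- The set `Min(A)`, as a type carrying the flat topology. -/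
def MinF : Type _ := {p : A // p ∈ minSpec A}

/-- A minimal `m`-prime element, as a point of `Spec(A)`. -/
def MinF.toSpec (p : MinF A) : Spec A := ⟨p.1, p.2.1⟩

/-- The topology of `Min_F(A)`: the restriction of the flat topology of `Spec(A)`. -/
instance [IsIntegral A] : TopologicalSpace (MinF A) :=
  TopologicalSpace.induced MinF.toSpec (flatTopology A)

/-- A Boolean space: compact, Hausdorff and totally disconnected. -/
def IsBooleanSpace (X : Type*) [TopologicalSpace X] : Prop :=
  CompactSpace X ∧ T2Space X ∧ TotallyDisconnectedSpace X

end Quantale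

set_option linter.unusedSectionVars false

/-! A complemented `e` cuts the minimal primes into the complementary open sets V(e) and V(¬e), so
purity of separation gives both the mp property and total separatedness. `Min_F(A)` is always
compact (`IsCoherent.compactSpace_minF`), and it is Hausdorff in the mp case because distinct
minimal primes are then comaximal. The way back to algebra is `IsMp.exists_eq_minV`. For a clopen U,
let a and b be the meets of the primes inside and outside U. Semiprimeness gives a ∧ b = 0, while
comaximality and compactness give a ∨ b = 1, so U = V(a) with a complemented. A basis of such sets
makes every minimal prime regular, and from there the Pierce spectrum and purity conditions follow
by arguments at a single prime. Conversely, minimal primes of an mp-quantale are pure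
(`IsMp.isPure_of_mem_minSpec`). -/

namespace Quantale

/-! ### Multiplication, complements and minimal primes -/

section Basic

variable {A : Type*} [CommMonoid A] [CompleteLattice A] [IsQuantale A]

theorem mul_le_left [IsIntegral A] (a b : A) : a * b ≤ a := (mul_le_inf a b).trans inf_le_left

theorem mul_le_right [IsIntegral A] (a b : A) : a * b ≤ b := (mul_le_inf a b).trans inf_le_right

theorem mul_top_eq [IsIntegral A] (a : A) : a * ⊤ = a := by
  rw [← IsIntegral.one_eq_top, mul_one]

theorem sup_mul_sup_le [IsIntegral A] (x a b : A) : (x ⊔ a) * (x ⊔ b) ≤ x ⊔ a * b := by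
  rw [sup_mul_distrib, mul_sup_distrib (x := a)]
  exact sup_le ((mul_le_left _ _).trans le_sup_left)
    (sup_le ((mul_le_right _ _).trans le_sup_left) le_sup_right)

theorem sup_mul_eq_top [IsIntegral A] {x a b : A} (ha : x ⊔ a = ⊤) (hb : x ⊔ b = ⊤) :
    x ⊔ a * b = ⊤ := by
  have h := sup_mul_sup_le x a b
  rwa [ha, hb, mul_top_eq, top_le_iff] at h

theorem le_neg {a x : A} (h : a * x = ⊥) : x ≤ neg a := le_sSup h

theorem mul_neg_eq_bot (a : A) : a * neg a = ⊥ := by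
  rw [neg, mul_sSup_distrib]
  simp

theorem IsMPrime.le_or_le {p a b : A} (hp : IsMPrime p) (h : a * b ≤ p) : a ≤ p ∨ b ≤ p :=
  hp.2 a b h

theorem IsMPrime.le_of_pow_le {p a : A} [IsIntegral A] (hp : IsMPrime p) (n : ℕ)
    (h : a ^ n ≤ p) : a ≤ p := by
  induction n with
  | zero =>
    rw [pow_zero, IsIntegral.one_eq_top, top_le_iff] at h
    exact absurd h hp.1
  | succ n ih =>
    rw [pow_succ] at h
    exact (hp.le_or_le h).elim ih id

theorem IsMPrime.sup_ne_top {p a b : A} (hp : IsMPrime p) (ha : a ≤ p) (hb : b ≤ p) :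
    a ⊔ b ≠ ⊤ := fun h => hp.1 (top_le_iff.1 (h ▸ sup_le ha hb))

theorem IsCompl.mul_eq_bot [IsIntegral A] {e f : A} (h : IsCompl e f) : e * f = ⊥ :=
  le_bot_iff.1 ((mul_le_inf e f).trans h.inf_eq_bot.le)

/-- Since x = xe ∨ xf, this serves as the substitute for lattice distributivity. -/
theorem le_of_mul_le_of_sup_eq_top [IsIntegral A] {x e f y : A} (h : e ⊔ f = ⊤)
    (he : x * e ≤ y) (hf : x * f ≤ y) : x ≤ y := by
  rw [← mul_top_eq x, ← h, mul_sup_distrib]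
  exact sup_le he hf

theorem neg_eq_of_isCompl [IsIntegral A] {e f : A} (h : IsCompl e f) : neg e = f := by
  refine le_antisymm ?_ (le_neg (IsCompl.mul_eq_bot h))
  refine le_of_mul_le_of_sup_eq_top h.sup_eq_top ?_ (mul_le_right _ _)
  rw [mul_comm, mul_neg_eq_bot]
  exact bot_le

theorem isCompl_neg [IsIntegral A] {e : A} (h : e ∈ booleanCenter A) : IsCompl e (neg e) := by
  obtain ⟨f, hf⟩ := h
  rwa [neg_eq_of_isCompl hf]

theorem neg_mem_booleanCenter [IsIntegral A] {e : A} (h : e ∈ booleanCenter A) :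
    neg e ∈ booleanCenter A := ⟨e, (isCompl_neg h).symm⟩

theorem IsMPrime.neg_le [IsIntegral A] {p e : A} (hp : IsMPrime p) (h : ¬ e ≤ p) :
    neg e ≤ p :=
  (hp.le_or_le ((mul_neg_eq_bot e).le.trans bot_le)).resolve_left h

theorem isCompl_of_mul_eq_bot [IsIntegral A] {e f : A} (h : e * f = ⊥) (h' : e ⊔ f = ⊤) :
    IsCompl e f := by
  refine ⟨disjoint_iff.2 (le_bot_iff.1 ?_), codisjoint_iff.2 h'⟩
  refine le_of_mul_le_of_sup_eq_top h' ?_ ?_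
  · exact (mul_le_mul_left inf_le_right e).trans (by rw [mul_comm, h])
  · exact (mul_le_mul_left inf_le_left f).trans h.le

theorem sup_mem_booleanCenter [IsIntegral A] {e f : A} (he : e ∈ booleanCenter A)
    (hf : f ∈ booleanCenter A) : e ⊔ f ∈ booleanCenter A := by
  refine ⟨neg e * neg f, isCompl_of_mul_eq_bot ?_ ?_⟩
  · rw [sup_mul_distrib, ← mul_assoc, mul_neg_eq_bot, bot_mul, mul_left_comm, mul_neg_eq_bot,
      mul_bot, sup_idem]
  · refine sup_mul_eq_top (top_le_iff.1 ?_) (top_le_iff.1 ?_)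
    · exact (isCompl_neg he).sup_eq_top.ge.trans (sup_le_sup_right le_sup_left _)
    · exact (isCompl_neg hf).sup_eq_top.ge.trans (sup_le_sup_right le_sup_right _)

theorem bot_mem_booleanCenter : (⊥ : A) ∈ booleanCenter A := ⟨⊤, isCompl_bot_top⟩

theorem IsRegularElement.sup {a b : A} (ha : IsRegularElement a) (hb : IsRegularElement b) :
    IsRegularElement (a ⊔ b) := by
  obtain ⟨E, hE, rfl⟩ := ha
  obtain ⟨F, hF, rfl⟩ := hb
  exact ⟨E ∪ F, Set.union_subset hE hF, sSup_union.symm⟩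

/-- A compact element below a regular element is below a complemented element below it. -/
theorem IsRegularElement.exists_complemented [IsIntegral A] {a c : A} (ha : IsRegularElement a)
    (hc : IsCompactElement c) (hca : c ≤ a) : ∃ e ∈ booleanCenter A, c ≤ e ∧ e ≤ a := by
  obtain ⟨E, hE, rfl⟩ := ha
  obtain ⟨t, ht, hct⟩ :=
    (CompleteLattice.isCompactElement_iff_exists_le_sSup_of_le_sSup A c).1 hc E hca
  refine ⟨t.sup id, ?_, hct, Finset.sup_le fun x hx => le_sSup (ht hx)⟩
  exact Finset.sup_induction (p := (· ∈ booleanCenter A)) bot_mem_booleanCenter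
    (fun _ h _ h' => sup_mem_booleanCenter h h') fun x hx => hE (ht hx)

theorem IsMPrime.exists_minimal_le {p : A} (hp : IsMPrime p) : ∃ q ∈ minSpec A, q ≤ p := by
  -- Zorn downwards: the meet of a chain of primes is prime.
  obtain ⟨m, hmp, hm⟩ := zorn_le_nonempty₀ (α := Aᵒᵈ) {q | IsMPrime (OrderDual.ofDual q)}
    (fun c hc hchain y hy => by
      refine ⟨OrderDual.toDual (sInf (OrderDual.toDual ⁻¹' c)), ⟨?_, ?_⟩, fun z hz => sInf_le hz⟩
      · intro h
        exact (hc hy).1 (top_le_iff.1 (h.ge.trans (sInf_le hy)))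
      · intro a b hab
        by_contra! hcon
        simp only [OrderDual.ofDual_toDual, le_sInf_iff, not_forall] at hcon
        obtain ⟨⟨x, hx, hax⟩, ⟨z, hz, hbz⟩⟩ := hcon
        rcases hchain.total hx hz with h | h
        · exact ((hc hz).2 a b (hab.trans (sInf_le hz))).elim
            (fun h' => hax (h'.trans h)) hbz
        · exact ((hc hx).2 a b (hab.trans (sInf_le hx))).elim
            hax (fun h' => hbz (h'.trans h)))
    (OrderDual.toDual p) hp
  exact ⟨OrderDual.ofDual m, ⟨hm.1, fun x hx hxm => hm.2 (y := OrderDual.toDual x) hx hxm⟩, hmp⟩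

/-- In a semiprime quantale, an element below all minimal `m`-primes vanishes. -/
theorem IsSemiprime.eq_bot (hsemi : IsSemiprime A) {a : A} (h : ∀ p ∈ minSpec A, a ≤ p) :
    a = ⊥ := by
  refine le_bot_iff.1 (le_trans (le_sInf fun p hp => ?_) hsemi.le)
  obtain ⟨q, hq, hqp⟩ := hp.1.exists_minimal_le
  exact (h q hq).trans hqp

theorem eq_of_minSpec_le {p q : A} (hp : p ∈ minSpec A) (hq : q ∈ minSpec A) (h : p ≤ q) :
    p = q := le_antisymm h (hq.2 hp.1 h)

theorem IsMp.eq (hmp : IsMp A) {m p q : A} (hm : IsMPrime m) (hp : p ∈ minSpec A)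
    (hq : q ∈ minSpec A) (hpm : p ≤ m) (hqm : q ≤ m) : p = q :=
  (hmp m hm).unique ⟨hp, hpm⟩ ⟨hq, hqm⟩

end Basic

/-! ### Compact elements and prime separation -/

section Compact

variable {A : Type*} [CommMonoid A] [CompleteLattice A]

theorem isCompactElement_sup {c d : A} (hc : IsCompactElement c) (hd : IsCompactElement d) :
    IsCompactElement (c ⊔ d) := by
  intro s u hs hdir hu h
  obtain ⟨x, hx, hcx⟩ := hc s u hs hdir hu (le_sup_left.trans h)
  obtain ⟨y, hy, hdy⟩ := hd s u hs hdir hu (le_sup_right.trans h)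
  obtain ⟨z, hz, hxz, hyz⟩ := hdir x hx y hy
  exact ⟨z, hz, sup_le (hcx.trans hxz) (hdy.trans hyz)⟩

theorem isCompactElement_bot : IsCompactElement (⊥ : A) :=
  fun _ _ ⟨x, hx⟩ _ _ _ => ⟨x, hx, bot_le⟩

variable [IsQuantale A]

theorem IsCoherent.le_of_compact (hcoh : IsCoherent A) {a b : A}
    (h : ∀ c : A, IsCompactElement c → c ≤ a → c ≤ b) : a ≤ b := by
  obtain ⟨X, hX, rfl⟩ := hcoh.algebraic a
  exact sSup_le fun c hc => h c (hX c hc) (le_sSup hc)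

theorem IsCoherent.pow_compact [IsIntegral A] (hcoh : IsCoherent A) {c : A}
    (hc : IsCompactElement c) (n : ℕ) : IsCompactElement (c ^ n) := by
  induction n with
  | zero => rw [pow_zero, IsIntegral.one_eq_top]; exact hcoh.top_compact
  | succ n ih => rw [pow_succ]; exact hcoh.mul_compact _ _ ih hc

/-- Elements witnessing a comaximality can be chosen compact. -/
theorem IsCoherent.exists_compact_sup_eq_top (hcoh : IsCoherent A) {a b : A} (h : a ⊔ b = ⊤) :
    ∃ c d : A, IsCompactElement c ∧ IsCompactElement d ∧ c ≤ a ∧ d ≤ b ∧ c ⊔ d = ⊤ := by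
  let s : Set A := {x | ∃ c d : A, IsCompactElement c ∧ IsCompactElement d ∧ c ≤ a ∧ d ≤ b ∧
    c ⊔ d = x}
  obtain ⟨x, ⟨c, d, hc, hd, hca, hdb, rfl⟩, hx⟩ := hcoh.top_compact s (sSup s)
    ⟨⊥ ⊔ ⊥, ⊥, ⊥, isCompactElement_bot, isCompactElement_bot, bot_le, bot_le, rfl⟩
    (by
      rintro _ ⟨c, d, hc, hd, hca, hdb, rfl⟩ _ ⟨c', d', hc', hd', hca', hdb', rfl⟩
      exact ⟨_, ⟨c ⊔ c', d ⊔ d', isCompactElement_sup hc hc', isCompactElement_sup hd hd', sup_le hca hca', sup_le hdb hdb', rfl⟩,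
        sup_le_sup le_sup_left le_sup_left, sup_le_sup le_sup_right le_sup_right⟩)
    (isLUB_sSup s)
    (by
      rw [← h]
      refine sup_le (hcoh.le_of_compact fun c hc hca => ?_)
        (hcoh.le_of_compact fun d hd hdb => ?_)
      · exact le_sup_left.trans (le_sSup ⟨c, ⊥, hc, isCompactElement_bot, hca, bot_le, rfl⟩)
      · exact le_sup_right.trans (le_sSup ⟨⊥, d, isCompactElement_bot, hd, bot_le, hdb, rfl⟩))
  exact ⟨c, d, hc, hd, hca, hdb, top_le_iff.1 hx⟩

variable [IsIntegral A]

/-- Prime separation: a multiplicatively closed set of compact elements avoiding the down-set of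
`a` is avoided by an `m`-prime element above `a`. -/
theorem exists_isMPrime_of_avoids {S : Set A} {a : A} (hne : S.Nonempty)
    (hcomp : ∀ s ∈ S, IsCompactElement s) (hmul : ∀ s ∈ S, ∀ t ∈ S, s * t ∈ S)
    (ha : ∀ s ∈ S, ¬ s ≤ a) : ∃ q, IsMPrime q ∧ a ≤ q ∧ ∀ s ∈ S, ¬ s ≤ q := by
  obtain ⟨q, haq, hq⟩ := zorn_le_nonempty₀ {x : A | ∀ s ∈ S, ¬ s ≤ x}
    (fun c hc hchain y hy => by
      refine ⟨sSup c, fun s hs hle => ?_, fun z hz => le_sSup hz⟩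
      obtain ⟨x, hx, hsx⟩ :=
        hcomp s hs c (sSup c) ⟨y, hy⟩ hchain.directedOn (isLUB_sSup c) hle
      exact hc hx s hs hsx) a ha
  refine ⟨q, ⟨?_, ?_⟩, haq, hq.1⟩
  · rintro rfl
    obtain ⟨s, hs⟩ := hne
    exact hq.1 s hs le_top
  · intro x y hxy
    by_contra! hcon
    have key : ∀ z : A, ¬ z ≤ q → ∃ s ∈ S, s ≤ q ⊔ z := by
      intro z hz
      by_contra! h
      exact hz (le_sup_right.trans (hq.2 h le_sup_left))
    obtain ⟨s, hs, hsx⟩ := key x hcon.1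
    obtain ⟨t, ht, hty⟩ := key y hcon.2
    exact hq.1 _ (hmul s hs t ht)
      ((mul_le_mul' hsx hty).trans ((sup_mul_sup_le q x y).trans (sup_le le_rfl hxy)))

theorem IsCoherent.exists_isMPrime_ge (hcoh : IsCoherent A) {a : A} (ha : a ≠ ⊤) :
    ∃ m, IsMPrime m ∧ a ≤ m := by
  obtain ⟨q, hq, haq, -⟩ := exists_isMPrime_of_avoids (S := {⊤}) (a := a) ⟨⊤, rfl⟩
    (by rintro _ rfl; exact hcoh.top_compact)
    (by rintro _ rfl _ rfl; exact mul_top_eq _)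
    (by rintro _ rfl; exact fun h => ha (top_le_iff.1 h))
  exact ⟨q, hq, haq⟩

/-- In a semiprime coherent quantale, `c^⊥ ≤ m` forces some minimal `m`-prime below `m` to
avoid `c`. -/
theorem IsCoherent.exists_minimal_not_ge (hcoh : IsCoherent A) (hsemi : IsSemiprime A) {m c : A}
    (hm : IsMPrime m) (hc : IsCompactElement c) (hcm : neg c ≤ m) :
    ∃ q ∈ minSpec A, q ≤ m ∧ ¬ c ≤ q := by
  have htop : IsCompactElement (⊤ : A) ∧ ¬ (⊤ : A) ≤ m :=
    ⟨hcoh.top_compact, fun h => hm.1 (top_le_iff.1 h)⟩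
  -- Localize at m and invert c: a prime avoiding all d * c ^ n, with d compact and not below m,
  -- lies under m and misses c.
  obtain ⟨q, hq, -, hqS⟩ := exists_isMPrime_of_avoids
    (S := {s | ∃ d, (IsCompactElement d ∧ ¬ d ≤ m) ∧ ∃ n : ℕ, s = d * c ^ n}) (a := ⊥)
    ⟨_, ⊤, htop, 0, rfl⟩
    (by
      rintro _ ⟨d, ⟨hd, -⟩, n, rfl⟩
      exact hcoh.mul_compact _ _ hd (hcoh.pow_compact hc n))
    (by
      rintro _ ⟨d, ⟨hd, hdm⟩, n, rfl⟩ _ ⟨d', ⟨hd', hdm'⟩, n', rfl⟩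
      refine ⟨d * d', ⟨hcoh.mul_compact _ _ hd hd', fun h => ?_⟩, n + n', ?_⟩
      · exact (hm.le_or_le h).elim hdm hdm'
      · rw [pow_add, mul_mul_mul_comm])
    (by
      rintro _ ⟨d, ⟨hd, hdm⟩, n, rfl⟩ h
      -- If d * c ^ n = 0, every minimal prime contains d or c, so c * d = 0 by semiprimeness and d
      -- ≤ c^⊥ ≤ m.
      refine hdm ((le_neg (hsemi.eq_bot fun p hp => ?_)).trans hcm)
      rcases hp.1.le_or_le (h.trans bot_le) with h' | h'
      · exact (mul_le_right c d).trans h'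
      · exact (mul_le_left c d).trans (hp.1.le_of_pow_le n h'))
  obtain ⟨q', hq', hle⟩ := hq.exists_minimal_le
  refine ⟨q', hq', hle.trans (hcoh.le_of_compact fun d hd hdq => ?_), fun h => ?_⟩
  · by_contra hdm
    exact hqS d ⟨d, ⟨hd, hdm⟩, 0, by rw [pow_zero, mul_one]⟩ hdq
  · exact hqS (⊤ * c ^ 1) ⟨⊤, htop, 1, rfl⟩
      ((mul_le_right _ _).trans (by rw [pow_one]; exact h.trans hle))

/-- A compact c ≤ e already comaximal with something below the complement must equal e. -/
theorem IsCoherent.compact_of_mem_booleanCenter (hcoh : IsCoherent A) {e : A}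
    (he : e ∈ booleanCenter A) : IsCompactElement e := by
  obtain ⟨f, hf⟩ := he
  obtain ⟨c, d, hc, -, hce, hdf, h⟩ := hcoh.exists_compact_sup_eq_top hf.sup_eq_top
  have : e ≤ c := le_of_mul_le_of_sup_eq_top h (mul_le_right _ _)
    ((mul_le_mul_right hdf e).trans ((IsCompl.mul_eq_bot hf).le.trans bot_le))
  rwa [le_antisymm this hce]

end Compact

/-! ### The flat topology on minimal primes -/

section Topology

variable {A : Type*} [CommMonoid A] [CompleteLattice A] [IsQuantale A] [IsIntegral A]

theorem isOpen_compl_V (a : A) : @IsOpen _ (zariskiTopology A) (V a)ᶜ := by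
  change (V a)ᶜᶜ ∈ Set.range (V (A := A))
  rw [compl_compl]
  exact ⟨a, rfl⟩

theorem IsCoherent.isCompact_compl_V (hcoh : IsCoherent A) {c : A} (hc : IsCompactElement c) :
    @IsCompact _ (zariskiTopology A) (V c)ᶜ := by
  let _ := zariskiTopology A
  refine isCompact_of_finite_subcover fun {ι} U hU hcover => ?_
  have hU' : ∀ i, ∃ a : A, V a = (U i)ᶜ := hU
  choose a ha using hU'
  have hmem : ∀ i (p : Spec A), p ∉ U i ↔ a i ≤ p.1 := fun i p => by
    rw [← Set.mem_compl_iff, ← ha]; rfl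
  obtain ⟨n, hn⟩ : ∃ n : ℕ, c ^ n ≤ ⨆ i, a i := by
    by_contra! hcon
    obtain ⟨q, hq, haq, hqS⟩ := exists_isMPrime_of_avoids (S := Set.range (c ^ · : ℕ → A))
      (a := ⨆ i, a i) (Set.range_nonempty _)
      (by rintro _ ⟨n, rfl⟩; exact hcoh.pow_compact hc n)
      (by rintro _ ⟨n, rfl⟩ _ ⟨n', rfl⟩; exact ⟨n + n', pow_add _ _ _⟩)
      (by rintro _ ⟨n, rfl⟩; exact hcon n)
    have hcq : ¬ c ≤ q := fun h => hqS _ ⟨1, rfl⟩ (by simpa using h)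
    obtain ⟨i, hi⟩ := Set.mem_iUnion.1 (hcover (show (⟨q, hq⟩ : Spec A) ∈ (V c)ᶜ from hcq))
    exact (hmem i ⟨q, hq⟩).2 ((le_iSup a i).trans haq) hi
  obtain ⟨t, ht⟩ := CompleteLattice.IsCompactElement.exists_finset_of_le_iSup A
    (hcoh.pow_compact hc n) a hn
  refine ⟨t, fun p hp => ?_⟩
  by_contra hcon
  simp only [Set.mem_iUnion, not_exists] at hcon
  exact hp (p.2.le_of_pow_le n (ht.trans (iSup₂_le fun i hi => (hmem i p).1 (hcon i hi))))

/-- The generating open sets of the flat topology are the `V(c)` with `c` compact. -/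
theorem IsCoherent.flat_generators (hcoh : IsCoherent A) :
    {U : Set (Spec A) | @IsCompact _ (zariskiTopology A) Uᶜ ∧ @IsOpen _ (zariskiTopology A) Uᶜ} =
      {U | ∃ c : A, IsCompactElement c ∧ U = V c} := by
  ext U
  constructor
  · rintro ⟨hcomp, a, ha⟩
    rw [compl_compl] at ha
    subst ha
    let _ := zariskiTopology A
    obtain ⟨t, ht⟩ := hcomp.elim_finite_subcover
      (fun c : {c : A // IsCompactElement c ∧ c ≤ a} => (V c.1)ᶜ)
      (fun c => isOpen_compl_V c.1) (fun p hp => by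
        by_contra hcon
        simp only [Set.mem_iUnion, not_exists, Set.mem_compl_iff, not_not] at hcon
        exact hp (hcoh.le_of_compact fun c hc hca => hcon ⟨c, hc, hca⟩))
    refine ⟨t.sup Subtype.val,
      CompleteLattice.isCompactElement_finsetSup t fun x _ => x.2.1, ?_⟩
    ext p
    refine ⟨fun h => (Finset.sup_le fun x _ => x.2.2).trans h, fun h => ?_⟩
    by_contra hp
    obtain ⟨c, hct, hc⟩ := Set.mem_iUnion₂.1 (ht hp)
    exact hc ((Finset.le_sup (f := Subtype.val) hct).trans h)
  · rintro ⟨c, hc, rfl⟩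
    exact ⟨hcoh.isCompact_compl_V hc, isOpen_compl_V c⟩

/-- The trace of `V(a)` on the space of minimal `m`-primes. -/
def minV (a : A) : Set (MinF A) := MinF.toSpec ⁻¹' V a

theorem IsCoherent.minF_topology_eq (hcoh : IsCoherent A) :
    TopologicalSpace.induced (MinF.toSpec (A := A)) (flatTopology A) =
      TopologicalSpace.generateFrom {U | ∃ c : A, IsCompactElement c ∧ U = minV c} := by
  rw [flatTopology, hcoh.flat_generators, induced_generateFrom_eq]
  congr 1
  ext U
  constructor
  · rintro ⟨_, ⟨c, hc, rfl⟩, rfl⟩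
    exact ⟨c, hc, rfl⟩
  · rintro ⟨c, hc, rfl⟩
    exact ⟨_, ⟨c, hc, rfl⟩, rfl⟩

theorem IsCoherent.isOpen_minV (hcoh : IsCoherent A) {c : A} (hc : IsCompactElement c) :
    IsOpen (minV c) := by
  have := TopologicalSpace.isOpen_generateFrom_of_mem
    (g := {U : Set (MinF A) | ∃ c : A, IsCompactElement c ∧ U = minV c}) ⟨c, hc, rfl⟩
  rwa [← hcoh.minF_topology_eq] at this

theorem IsCoherent.isOpen_minV_of_mem_booleanCenter (hcoh : IsCoherent A) {e : A}
    (he : e ∈ booleanCenter A) : IsOpen (minV e) :=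
  hcoh.isOpen_minV (hcoh.compact_of_mem_booleanCenter he)

theorem compl_minV {e : A} (he : e ∈ booleanCenter A) : (minV e)ᶜ = minV (neg e) := by
  ext p
  exact ⟨fun h => p.2.1.neg_le h, fun h h' => p.2.1.sup_ne_top h' h (isCompl_neg he).sup_eq_top⟩

/-- The space of minimal `m`-primes is compact in the flat topology. -/
theorem IsCoherent.compactSpace_minF (hcoh : IsCoherent A) : CompactSpace (MinF A) := by
  refine ⟨isCompact_generateFrom hcoh.minF_topology_eq fun P hP hcover => ?_⟩
  by_contra! hcon
  -- By Alexander's subbasis theorem only covers by sets V(c) matter. The compact s whose V(s) is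
  -- finitely covered form a multiplicative set; without a finite subcover it avoids 0. A minimal
  -- prime under the resulting q lies in no member of the cover.
  obtain ⟨q, hq, -, hqS⟩ := exists_isMPrime_of_avoids
    (S := {s : A | IsCompactElement s ∧ ∃ Q ⊆ P, Q.Finite ∧ minV s ⊆ ⋃₀ Q}) (a := ⊥)
    ⟨⊤, hcoh.top_compact, ∅, Set.empty_subset _, Set.finite_empty,
      fun p hp => absurd (top_le_iff.1 hp) p.2.1.1⟩
    (fun s hs => hs.1)
    (by
      rintro s ⟨hs, Q, hQP, hQ, hsQ⟩ t ⟨ht, R, hRP, hR, htR⟩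
      refine ⟨hcoh.mul_compact s t hs ht, Q ∪ R, Set.union_subset hQP hRP, hQ.union hR, ?_⟩
      rw [Set.sUnion_union]
      exact fun p hp => (p.2.1.le_or_le hp).imp (fun h => hsQ h) (fun h => htR h))
    (by
      rintro s ⟨hs, Q, hQP, hQ, hsQ⟩ h
      exact hcon Q hQP hQ fun p _ => hsQ (h.trans bot_le))
  obtain ⟨q', hq', hle⟩ := hq.exists_minimal_le
  obtain ⟨U, hUP, hU⟩ := hcover (Set.mem_univ (⟨q', hq'⟩ : MinF A))
  obtain ⟨c, hc, rfl⟩ := hP hUP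
  exact hqS c ⟨hc, {minV c}, Set.singleton_subset_iff.2 hUP, Set.finite_singleton _, by simp⟩
    (hU.trans hle)

theorem IsMp.sup_eq_top (hmp : IsMp A) (hcoh : IsCoherent A) {p q : A} (hp : p ∈ minSpec A)
    (hq : q ∈ minSpec A) (hne : p ≠ q) : p ⊔ q = ⊤ := by
  by_contra h
  obtain ⟨m, hm, hle⟩ := hcoh.exists_isMPrime_ge h
  exact hne (hmp.eq hm hp hq (le_sup_left.trans hle) (le_sup_right.trans hle))

theorem IsMp.t2Space_minF (hmp : IsMp A) (hcoh : IsCoherent A) : T2Space (MinF A) := by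
  refine ⟨fun p q hne => ?_⟩
  obtain ⟨c, d, hc, hd, hcp, hdq, h⟩ := hcoh.exists_compact_sup_eq_top
    (hmp.sup_eq_top hcoh p.2 q.2 fun h => hne (Subtype.ext h))
  exact ⟨minV c, minV d, hcoh.isOpen_minV hc, hcoh.isOpen_minV hd, hcp, hdq,
    Set.disjoint_left.2 fun r hr hr' => r.2.1.sup_ne_top hr hr' h⟩

/-- In an `mp`-quantale, a minimal `m`-prime is comaximal with the meet of any compact set of
minimal `m`-primes not containing it. -/
theorem IsMp.sup_sInf_eq_top (hmp : IsMp A) (hcoh : IsCoherent A) {K : Set (MinF A)}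
    (hK : IsCompact K) {p : MinF A} (hp : p ∉ K) : p.toSpec.1 ⊔ ⨅ q ∈ K, q.toSpec.1 = ⊤ := by
  -- Compact induction: comaximality survives finite unions because a product lies below the meet,
  -- and near q one compact d ≤ q bounds all the primes of V(d) from below.
  refine hK.induction_on (p := fun s => p.toSpec.1 ⊔ ⨅ q ∈ s, q.toSpec.1 = ⊤) (by simp)
    (fun s t hst h => ?_) (fun s t hs ht => ?_) fun q hq => ?_
  · exact top_le_iff.1 (h.ge.trans (sup_le_sup_left (biInf_mono hst) _))
  · rw [iInf_union]
    exact top_le_iff.1 ((sup_mul_eq_top hs ht).ge.trans (sup_le_sup_left (mul_le_inf _ _) _))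
  · obtain ⟨c, d, hc, hd, hcp, hdq, h⟩ := hcoh.exists_compact_sup_eq_top
      (hmp.sup_eq_top hcoh p.2 q.2 fun h => hp (by rwa [Subtype.ext h]))
    refine ⟨minV d, mem_nhdsWithin_of_mem_nhds ((hcoh.isOpen_minV hd).mem_nhds hdq), ?_⟩
    refine top_le_iff.1 (h.ge.trans (sup_le_sup hcp (le_iInf₂ fun r hr => hr)))

/-- In a semiprime coherent `mp`-quantale, the clopen sets of minimal `m`-primes are given by
complemented elements. -/
theorem IsMp.exists_eq_minV (hmp : IsMp A) (hcoh : IsCoherent A) (hsemi : IsSemiprime A)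
    {U : Set (MinF A)} (hU : IsClopen U) : ∃ e ∈ booleanCenter A, U = minV e := by
  have := hcoh.compactSpace_minF
  let a : A := ⨅ q ∈ U, q.toSpec.1
  let b : A := ⨅ q ∈ Uᶜ, q.toSpec.1
  have hUa : ∀ p ∈ U, a ≤ p.toSpec.1 := fun p hp => iInf₂_le p hp
  have hUb : ∀ p ∉ U, b ≤ p.toSpec.1 := fun p hp => iInf₂_le p hp
  have hinf : a ⊓ b = ⊥ := hsemi.eq_bot fun p hp => by
    by_cases h : (⟨p, hp⟩ : MinF A) ∈ U
    · exact inf_le_left.trans (hUa _ h)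
    · exact inf_le_right.trans (hUb _ h)
  have hsup : a ⊔ b = ⊤ := by
    by_contra h
    obtain ⟨m, hm, hle⟩ := hcoh.exists_isMPrime_ge h
    obtain ⟨p, hp, hpm⟩ := hm.exists_minimal_le
    by_cases hpU : (⟨p, hp⟩ : MinF A) ∈ U
    · exact hm.sup_ne_top hpm (le_sup_right.trans hle)
        (hmp.sup_sInf_eq_top hcoh (p := ⟨p, hp⟩) hU.compl.isClosed.isCompact (fun h => h hpU))
    · exact hm.sup_ne_top hpm (le_sup_left.trans hle)
        (hmp.sup_sInf_eq_top hcoh (p := ⟨p, hp⟩) hU.isClosed.isCompact hpU)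
  refine ⟨a, ⟨b, disjoint_iff.2 hinf, codisjoint_iff.2 hsup⟩, ?_⟩
  ext p
  refine ⟨hUa p, fun h => ?_⟩
  by_contra hp
  exact p.2.1.sup_ne_top h (hUb p hp) hsup

end Topology

/-! ### Purification, regularity and purity -/

section Purified

variable {A : Type*} [CommMonoid A] [CompleteLattice A] [IsQuantale A] [IsIntegral A]

theorem IsPurified.isMp (h : IsPurified A) : IsMp A := by
  intro p hp
  obtain ⟨q, hq, hqp⟩ := IsMPrime.exists_minimal_le hp
  refine ⟨q, ⟨hq, hqp⟩, ?_⟩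
  rintro r ⟨hr, hrp⟩
  by_contra hne
  obtain ⟨e, he, her, heq⟩ := h r hr q hq hne
  exact IsMPrime.sup_ne_top hp (her.trans hrp) (heq.trans hqp) (isCompl_neg he).sup_eq_top

theorem IsPurified.totallySeparatedSpace (h : IsPurified A) (hcoh : IsCoherent A) :
    TotallySeparatedSpace (MinF A) := by
  refine totallySeparatedSpace_iff_exists_isClopen.2 fun p q hne => ?_
  obtain ⟨e, he, hep, heq⟩ := h p.1 p.2 q.1 q.2 fun h => hne (Subtype.ext h)
  refine ⟨minV e, ⟨⟨?_⟩, hcoh.isOpen_minV_of_mem_booleanCenter he⟩, hep, ?_⟩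
  · rw [compl_minV he]
    exact hcoh.isOpen_minV_of_mem_booleanCenter (neg_mem_booleanCenter he)
  · rw [compl_minV he]
    exact heq

theorem IsMp.isTopologicalBasis_minV (hmp : IsMp A) (hcoh : IsCoherent A)
    (hsemi : IsSemiprime A) (hbool : IsBooleanSpace (MinF A)) :
    TopologicalSpace.IsTopologicalBasis
      {U : Set (MinF A) | ∃ e ∈ booleanCenter A, U = minV e} := by
  obtain ⟨_, _, _⟩ := hbool
  convert isTopologicalBasis_isClopen (X := MinF A) using 1
  ext U
  refine ⟨?_, hmp.exists_eq_minV hcoh hsemi⟩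
  rintro ⟨e, he, rfl⟩
  refine ⟨⟨?_⟩, hcoh.isOpen_minV_of_mem_booleanCenter he⟩
  rw [compl_minV he]
  exact hcoh.isOpen_minV_of_mem_booleanCenter (neg_mem_booleanCenter he)

theorem isRegularElement_of_exists (hcoh : IsCoherent A) {a : A}
    (h : ∀ c : A, IsCompactElement c → c ≤ a → ∃ e ∈ booleanCenter A, c ≤ e ∧ e ≤ a) :
    IsRegularElement a := by
  refine ⟨{e | e ∈ booleanCenter A ∧ e ≤ a}, fun e he => he.1, le_antisymm ?_ ?_⟩
  · refine hcoh.le_of_compact fun c hc hca => ?_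
    obtain ⟨e, he, hce, hea⟩ := h c hc hca
    exact hce.trans (le_sSup ⟨he, hea⟩)
  · exact sSup_le fun e he => he.2

/-- For compact c ≤ p, choose a basic V(e) around p inside V(c). Every minimal prime contains c or
¬e, so c * ¬e = 0 and hence c ≤ e ≤ p. -/
theorem isRegularElement_of_isTopologicalBasis (hcoh : IsCoherent A) (hsemi : IsSemiprime A)
    (hbasis : TopologicalSpace.IsTopologicalBasis
      {U : Set (MinF A) | ∃ e ∈ booleanCenter A, U = minV e}) {p : A} (hp : p ∈ minSpec A) :
    IsRegularElement p := by
  refine isRegularElement_of_exists hcoh fun c hc hcp => ?_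
  obtain ⟨_, ⟨e, he, rfl⟩, hep, hsub⟩ := hbasis.exists_subset_of_mem_open
    (show (⟨p, hp⟩ : MinF A) ∈ minV c from hcp) (hcoh.isOpen_minV hc)
  refine ⟨e, he, ?_, hep⟩
  refine le_of_mul_le_of_sup_eq_top (isCompl_neg he).sup_eq_top (mul_le_right _ _) ?_
  refine le_trans (le_of_eq (hsemi.eq_bot fun q hq => ?_)) bot_le
  by_cases h : e ≤ q
  · exact (mul_le_left _ _).trans (hsub (show (⟨q, hq⟩ : MinF A) ∈ minV e from h))
  · exact (mul_le_right _ _).trans (hq.1.neg_le h)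

/-- A regular x ≥ p with some complemented e ≤ x outside p also contains ¬e ≤ p, so x = 1.
Conversely, a maximal proper regular x absorbs any minimal prime sharing a prime upper bound with
it. -/
theorem minSpec_eq_pierceSpectrum (hcoh : IsCoherent A)
    (hreg : ∀ p ∈ minSpec A, IsRegularElement p) : minSpec A = pierceSpectrum A := by
  have hsub : minSpec A ⊆ pierceSpectrum A := by
    refine fun p hp => ⟨⟨hp.1.1, hreg p hp⟩, ?_⟩
    rintro x ⟨hx, E, hE, rfl⟩ hpx
    refine sSup_le fun e he => ?_
    by_contra hep
    refine hx (top_le_iff.1 ((isCompl_neg (hE he)).sup_eq_top.ge.trans ?_))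
    exact sup_le (le_sSup he) ((hp.1.neg_le hep).trans hpx)
  refine hsub.antisymm fun x hx => ?_
  obtain ⟨m, hm, hxm⟩ := hcoh.exists_isMPrime_ge hx.1.1
  obtain ⟨p, hp, hpm⟩ := hm.exists_minimal_le
  have hpx : p ≤ x :=
    le_sup_right.trans (hx.2 ⟨hm.sup_ne_top hxm hpm, hx.1.2.sup (hreg p hp)⟩ le_sup_left)
  rwa [le_antisymm ((hsub hp).2 hx.1 hpx) hpx]

theorem isPurified_of_isRegularElement (hreg : ∀ p ∈ minSpec A, IsRegularElement p) :
    IsPurified A := by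
  intro p hp q hq hne
  obtain ⟨E, hE, hpE⟩ := hreg p hp
  by_contra! hcon
  refine hne (eq_of_minSpec_le hp hq (hpE.le.trans (sSup_le fun e he => ?_)))
  by_contra heq
  exact hcon e (hE he) ((le_sSup he).trans hpE.ge) (hq.1.neg_le heq)

/-- Here r is the largest regular element below a, and c ≤ r is tested locally: if the residual x of
r by c were proper, take primes p ≤ m with x ≤ m and p minimal. Some complemented e ≤ p has c * ¬e ≤
r, so m contains both e and ¬e. -/
theorem IsPure.isRegularElement (hcoh : IsCoherent A)
    (hreg : ∀ p ∈ minSpec A, IsRegularElement p) {a : A} (ha : IsPure a) :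
    IsRegularElement a := by
  set r : A := sSup {e | e ∈ booleanCenter A ∧ e ≤ a} with hr
  have hra : r = a := by
    refine le_antisymm (sSup_le fun e he => he.2) (hcoh.le_of_compact fun c hc hca => ?_)
    set x : A := sSup {g | c * g ≤ r} with hx
    have hcx : c * x ≤ r := by
      rw [hx, mul_sSup_distrib]
      exact iSup₂_le fun g hg => hg
    by_cases hxtop : x = ⊤
    · rwa [hxtop, mul_top_eq] at hcx
    exfalso
    obtain ⟨m, hm, hxm⟩ := hcoh.exists_isMPrime_ge hxtop
    obtain ⟨p, hp, hpm⟩ := hm.exists_minimal_le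
    have key : ∀ e ∈ booleanCenter A, e ≤ p → ¬ c * neg e ≤ r := fun e he hep h =>
      hm.sup_ne_top (hep.trans hpm) ((le_sSup (show neg e ∈ {g | c * g ≤ r} from h)).trans hxm) (isCompl_neg he).sup_eq_top
    -- If c ≤ p, regularity of p gives e ≥ c, whence c * ¬e = 0. Otherwise c^⊥ ≤ p, so purity gives
    -- p ∨ a = 1 and an e ≤ p with ¬e ≤ a.
    by_cases hcp : c ≤ p
    · obtain ⟨e, he, hce, hep⟩ := (hreg p hp).exists_complemented hc hcp
      refine key e he hep ((mul_le_mul_left hce _).trans ?_)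
      rw [mul_neg_eq_bot]
      exact bot_le
    · have hap : p ⊔ a = ⊤ := by
        rw [sup_comm]
        exact top_le_iff.1 ((ha c hc hca).ge.trans (sup_le_sup_left (hp.1.neg_le hcp) _))
      obtain ⟨d, f, hd, -, hdp, hfa, hdf⟩ := hcoh.exists_compact_sup_eq_top hap
      obtain ⟨e, he, hde, hep⟩ := (hreg p hp).exists_complemented hd hdp
      refine key e he hep ((mul_le_right _ _).trans (le_sSup ⟨neg_mem_booleanCenter he, ?_⟩))
      refine le_of_mul_le_of_sup_eq_top hdf ?_ ((mul_le_right _ _).trans hfa)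
      refine (mul_le_mul_right hde _).trans ?_
      rw [mul_comm, mul_neg_eq_bot]
      exact bot_le
  exact ⟨_, fun e he => he.1, hra.symm⟩

/-- A prime m above p ∨ c^⊥ would lie over a minimal prime missing c, which uniqueness identifies
with p ≥ c. -/
theorem IsMp.isPure_of_mem_minSpec (hmp : IsMp A) (hcoh : IsCoherent A) (hsemi : IsSemiprime A)
    {p : A} (hp : p ∈ minSpec A) : IsPure p := by
  intro c hc hcp
  by_contra h
  obtain ⟨m, hm, hle⟩ := hcoh.exists_isMPrime_ge h
  obtain ⟨q, hq, hqm, hcq⟩ :=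
    hcoh.exists_minimal_not_ge hsemi hm hc (le_sup_right.trans hle)
  rw [hmp.eq hm hq hp hqm (le_sup_left.trans hle)] at hcq
  exact hcq hcp

end Purified

end Quantale

theorem theorem7p5 (A : Type*) [CommMonoid A] [CompleteLattice A] [IsQuantale A]
    [Quantale.IsIntegral A] (hcoh : Quantale.IsCoherent A) (hsemi : Quantale.IsSemiprime A) :
    List.TFAE [
      Quantale.IsPurified A,
      Quantale.IsMp A ∧ TotallySeparatedSpace (Quantale.MinF A),
      Quantale.IsMp A ∧ TotallyDisconnectedSpace (Quantale.MinF A),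
      Quantale.IsMp A ∧ Quantale.IsBooleanSpace (Quantale.MinF A),
      TopologicalSpace.IsTopologicalBasis
        {U : Set (Quantale.MinF A) |
          ∃ e ∈ Quantale.booleanCenter A, U = Quantale.MinF.toSpec ⁻¹' Quantale.V e},
      ∀ p ∈ Quantale.minSpec A, Quantale.IsRegularElement p,
      Quantale.minSpec A = Quantale.pierceSpectrum A,
      Quantale.IsMp A ∧ ∀ a : A, Quantale.IsPure a → Quantale.IsRegularElement a] := by
  tfae_have 1 → 2 := fun h => ⟨h.isMp, h.totallySeparatedSpace hcoh⟩
  tfae_have 2 → 3 := fun ⟨hmp, _⟩ => ⟨hmp, inferInstance⟩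
  tfae_have 3 → 4 := fun ⟨hmp, h⟩ => ⟨hmp, hcoh.compactSpace_minF, hmp.t2Space_minF hcoh, h⟩
  tfae_have 4 → 5 := fun ⟨hmp, h⟩ => hmp.isTopologicalBasis_minV hcoh hsemi h
  tfae_have 5 → 6 := fun h _ hp =>
    Quantale.isRegularElement_of_isTopologicalBasis hcoh hsemi h hp
  tfae_have 6 → 7 := Quantale.minSpec_eq_pierceSpectrum hcoh
  tfae_have 7 → 6 := fun h p hp => (h.subset hp).1.2
  tfae_have 6 → 1 := Quantale.isPurified_of_isRegularElement
  tfae_have 6 → 8 := fun h =>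
    ⟨(Quantale.isPurified_of_isRegularElement h).isMp, fun _ ha => ha.isRegularElement hcoh h⟩
  tfae_have 8 → 6 := fun ⟨hmp, h⟩ p hp => h p (hmp.isPure_of_mem_minSpec hcoh hsemi hp)
  tfae_finish
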